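/- Let $G$ be a virtually abelian group (i.e. $G$ has an abelian subgroup of finite index), let $S\subseteq G$ be a finite set that generates $G$ as a monoid, let $\omega\colon S\to\{1,2,3,\dots\}$ be any weight function, and let $H\le G$ be any subgroup. Define the weight of a word $s_1s_2\cdots s_k$ over $S$ ($k\ge 0$) to be $\sum_{i=1}^k\omega(s_i)$, the weight $\omega(g)$ of $g\in G$ to be the minimal weight of a word over $S$ representing $g$, and the weight of a right coset $Hg\in H\backslash G$ to be $\omega(Hg)=\min\{\omega(g')\mid g'\in Hg\}$. Then for every $n\ge 0$ the number $\sigma(n)=\#\{c\in H\backslash G\mid \omega(c)=n\}$ is finite, and the weighted growth series of $H\backslash G$, \[ \sum_{n=0}^{\infty}\sigma(n)z^n , \] is rational: there are polynomials $p,q$ with integer coefficients, $q\neq 0$, such that it equals $p(z)/q(z)$. -/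

import Mathlib

open scoped Polynomial PowerSeries

namespace CosetGrowth

/-- A group is virtually abelian if it has an abelian subgroup of finite index. -/
def IsVirtuallyAbelian (G : Type*) [Group G] : Prop :=
  ∃ A : Subgroup G, IsMulCommutative A ∧ A.FiniteIndex

/-- The group element represented by a word over `S`. -/
def wordValue {G : Type*} [Group G] {S : Set G} (w : List S) : G :=
  (w.map (fun s => (s : G))).prod

/-- The weight of a word: the sum of the weights of its letters. -/
def wordWeight {G : Type*} {S : Set G} (ω : S → ℕ+) (w : List S) : ℕ :=
  (w.map (fun s => (ω s : ℕ))).sum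

/-- The weight of a group element: the minimal weight of a word over `S` that represents it.
(The set is nonempty when `S` generates `G` as a monoid.) -/
noncomputable def elementWeight {G : Type*} [Group G] {S : Set G} (ω : S → ℕ+) (g : G) : ℕ :=
  sInf {n | ∃ w : List S, wordValue w = g ∧ wordWeight ω w = n}

/-- The set `H \ G` of right cosets `Hg`. -/
abbrev RightCosets {G : Type*} [Group G] (H : Subgroup G) : Type _ :=
  Quotient (QuotientGroup.rightRel H)

/-- The weight of a right coset: the minimal weight of its elements. -/
noncomputable def cosetWeight {G : Type*} [Group G] {S : Set G} (ω : S → ℕ+)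
    (H : Subgroup G) (c : RightCosets H) : ℕ :=
  sInf {n | ∃ g : G, (Quotient.mk (QuotientGroup.rightRel H) g) = c ∧ elementWeight ω g = n}

/-- The right cosets of `H` of weight exactly `n`. -/
def cosetSphere {G : Type*} [Group G] {S : Set G} (ω : S → ℕ+)
    (H : Subgroup G) (n : ℕ) : Set (RightCosets H) :=
  {c | cosetWeight ω H c = n}

/-- The weighted growth series of `H \ G`: the coefficient of `z ^ n` is the number of right
cosets of weight `n`. -/
noncomputable def cosetGrowthSeries {G : Type*} [Group G] {S : Set G} (ω : S → ℕ+)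
    (H : Subgroup G) : ℤ⟦X⟧ :=
  PowerSeries.mk fun n => ((cosetSphere ω H n).ncard : ℤ)

/-- A power series over `ℤ` is rational if it equals `p / q` for integer polynomials `p` and
`q ≠ 0`; as `ℤ⟦X⟧` is a domain, this is the identity `q * f = p`. -/
def IsRationalSeries (f : ℤ⟦X⟧) : Prop :=
  ∃ p q : ℤ[X], q ≠ 0 ∧ (q : ℤ⟦X⟧) * f = (p : ℤ⟦X⟧)

end CosetGrowth

namespace CosetGrowth

open Pointwise

/-! ### Rational power series -/

theorem IsRationalSeries.of_polynomial (p : ℤ[X]) : IsRationalSeries (p : ℤ⟦X⟧) :=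
  ⟨p, 1, one_ne_zero, by simp⟩

theorem IsRationalSeries.zero : IsRationalSeries 0 := by
  simpa using IsRationalSeries.of_polynomial 0

theorem IsRationalSeries.add {f g : ℤ⟦X⟧} (hf : IsRationalSeries f) (hg : IsRationalSeries g) :
    IsRationalSeries (f + g) := by
  obtain ⟨p, q, hq, h⟩ := hf
  obtain ⟨p', q', hq', h'⟩ := hg
  refine ⟨p * q' + p' * q, q * q', mul_ne_zero hq hq', ?_⟩
  push_cast
  rw [← h, ← h']
  ring

theorem IsRationalSeries.neg {f : ℤ⟦X⟧} (hf : IsRationalSeries f) : IsRationalSeries (-f) := by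
  obtain ⟨p, q, hq, h⟩ := hf
  exact ⟨-p, q, hq, by rw [Polynomial.coe_neg, ← h]; ring⟩

theorem IsRationalSeries.sub {f g : ℤ⟦X⟧} (hf : IsRationalSeries f) (hg : IsRationalSeries g) :
    IsRationalSeries (f - g) := by
  rw [sub_eq_add_neg]
  exact hf.add hg.neg

theorem IsRationalSeries.polynomial_mul {f : ℤ⟦X⟧} (p : ℤ[X]) (hf : IsRationalSeries f) :
    IsRationalSeries ((p : ℤ⟦X⟧) * f) := by
  obtain ⟨p', q, hq, h⟩ := hf
  refine ⟨p * p', q, hq, ?_⟩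
  push_cast
  rw [← h]
  ring

theorem IsRationalSeries.X_pow_mul {f : ℤ⟦X⟧} (d : ℕ) (hf : IsRationalSeries f) :
    IsRationalSeries ((PowerSeries.X : ℤ⟦X⟧) ^ d * f) := by
  simpa using hf.polynomial_mul (Polynomial.X ^ d)

theorem IsRationalSeries.of_polynomial_mul {f : ℤ⟦X⟧} {p : ℤ[X]} (hp : p ≠ 0)
    (hf : IsRationalSeries ((p : ℤ⟦X⟧) * f)) : IsRationalSeries f := by
  obtain ⟨p', q, hq, h⟩ := hf
  refine ⟨p', q * p, mul_ne_zero hq hp, ?_⟩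
  push_cast
  rw [← h]
  ring

theorem IsRationalSeries.sum {ι : Type*} (s : Finset ι) {f : ι → ℤ⟦X⟧}
    (hf : ∀ i ∈ s, IsRationalSeries (f i)) : IsRationalSeries (∑ i ∈ s, f i) :=
  Finset.sum_induction _ _ (fun _ _ => IsRationalSeries.add) .zero hf

/-! ### Counting series of a set with respect to an additive weight -/

section WeightSeries

variable {M N : Type*} [AddCommMonoid M] [AddCommMonoid N]

/-- The series whose `n`-th coefficient is the number of elements of `s` of weight `n`. -/
noncomputable def weightSeries (wt : M →+ ℕ) (s : Set M) : ℤ⟦X⟧ :=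
  PowerSeries.mk fun n => ((s ∩ {x | wt x = n}).ncard : ℤ)

variable {wt : M →+ ℕ}

@[simp]
theorem weightSeries_empty : weightSeries wt ∅ = 0 := by
  ext n
  simp [weightSeries]

theorem weightSeries_union_add_inter (hfin : ∀ n, {x | wt x = n}.Finite) (s t : Set M) :
    weightSeries wt (s ∪ t) + weightSeries wt (s ∩ t) = weightSeries wt s + weightSeries wt t := by
  ext n
  simp only [weightSeries, map_add, PowerSeries.coeff_mk]
  norm_cast
  rw [Set.union_inter_distrib_right, Set.inter_inter_distrib_right]
  exact Set.ncard_union_add_ncard_inter _ _ ((hfin n).subset Set.inter_subset_right)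
    ((hfin n).subset Set.inter_subset_right)

theorem weightSeries_union (hfin : ∀ n, {x | wt x = n}.Finite) {s t : Set M}
    (hst : Disjoint s t) : weightSeries wt (s ∪ t) = weightSeries wt s + weightSeries wt t := by
  rw [← weightSeries_union_add_inter hfin, hst.inter_eq, weightSeries_empty, add_zero]

theorem weightSeries_image {wt' : N →+ ℕ} {f : N → M} {d : ℕ} (hf : ∀ y, wt (f y) = d + wt' y)
    {s : Set N} (hs : s.InjOn f) :
    weightSeries wt (f '' s) = (PowerSeries.X : ℤ⟦X⟧) ^ d * weightSeries wt' s := by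
  ext n
  simp only [weightSeries, PowerSeries.coeff_X_pow_mul', PowerSeries.coeff_mk]
  split_ifs with h
  · rw [← (hs.mono Set.inter_subset_left).ncard_image]
    congr 2
    ext x
    simp only [Set.mem_inter_iff, Set.mem_image, Set.mem_ofPred_eq]
    constructor
    · rintro ⟨⟨y, hy, rfl⟩, hx⟩
      exact ⟨y, ⟨hy, by have := hf y; omega⟩, rfl⟩
    · rintro ⟨y, ⟨hy, hx⟩, rfl⟩
      exact ⟨⟨y, hy, rfl⟩, by have := hf y; omega⟩
  · rw [Nat.cast_eq_zero]
    convert Set.ncard_empty M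
    rw [Set.eq_empty_iff_forall_notMem]
    rintro _ ⟨⟨y, hy, rfl⟩, hx⟩
    have := hf y
    simp only [Set.mem_ofPred_eq] at hx
    omega

/-- Inclusion-exclusion: if the members of an intersection-closed family of sets have rational
counting series, then so do their finite unions. -/
theorem isRationalSeries_weightSeries_biUnion (hfin : ∀ n, {x | wt x = n}.Finite)
    {C : Set M → Prop} (hC : ∀ s t, C s → C t → C (s ∩ t))
    (hrat : ∀ s, C s → IsRationalSeries (weightSeries wt s)) {ι : Type*} (I : Finset ι)
    {s : ι → Set M} (hs : ∀ i ∈ I, C (s i)) :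
    IsRationalSeries (weightSeries wt (⋃ i ∈ I, s i)) := by
  classical
  induction I using Finset.induction_on generalizing s with
  | empty => simpa using IsRationalSeries.zero
  | insert a I ha ih =>
    simp only [Finset.mem_insert, forall_eq_or_imp] at hs
    rw [Finset.set_biUnion_insert, eq_sub_of_add_eq (weightSeries_union_add_inter hfin _ _)]
    refine ((hrat _ hs.1).add (ih hs.2)).sub ?_
    rw [Set.inter_iUnion₂]
    exact ih fun i hi => hC _ _ hs.1 (hs.2 i hi)

end WeightSeries

/-! ### Counting series in `ℕ ^ k` -/

section Pi

variable {κ : Type*} [DecidableEq κ] {wt : (κ → ℕ) →+ ℕ}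

theorem apply_le_weight (hwt : ∀ j, 0 < wt (Pi.single j 1)) (y : κ → ℕ) (j : κ) :
    y j ≤ wt y := by
  have h : y = Pi.single j (y j) + Function.update y j 0 := by
    ext i
    by_cases hi : i = j
    · subst hi; simp
    · simp [hi]
  have h' : (Pi.single j (y j) : κ → ℕ) = y j • Pi.single j 1 := by
    rw [← Pi.single_smul]; simp
  calc y j ≤ y j * wt (Pi.single j 1) := Nat.le_mul_of_pos_right _ (hwt j)
    _ = wt (Pi.single j (y j)) := by rw [h', map_nsmul, smul_eq_mul]
    _ ≤ wt y := by conv_rhs => rw [h, map_add]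
                   exact Nat.le_add_right _ _

theorem finite_weight_eq [Finite κ] (hwt : ∀ j, 0 < wt (Pi.single j 1)) (n : ℕ) :
    {y | wt y = n}.Finite := by
  have := Fintype.ofFinite κ
  refine (Set.finite_Iic (fun _ : κ => n)).subset fun y hy j => ?_
  rw [← (hy : wt y = n)]
  exact apply_le_weight hwt y j

theorem eq_zero_of_weight_eq_zero (hwt : ∀ j, 0 < wt (Pi.single j 1)) {y : κ → ℕ}
    (hy : wt y = 0) : y = 0 := by
  ext j
  simpa [hy] using apply_le_weight hwt y j

theorem isRationalSeries_weightSeries_support_subset [Finite κ]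
    (hwt : ∀ j, 0 < wt (Pi.single j 1)) (J : Finset κ) :
    IsRationalSeries (weightSeries wt {y | ∀ j ∉ J, y j = 0}) := by
  induction J using Finset.induction_on with
  | empty =>
    have h : {y : κ → ℕ | ∀ j ∉ (∅ : Finset κ), y j = 0} = {0} := by
      ext y; simp [funext_iff]
    have h1 : weightSeries wt {0} = ((1 : ℤ[X]) : ℤ⟦X⟧) := by
      ext n
      rw [Polynomial.coe_one, PowerSeries.coeff_one, weightSeries, PowerSeries.coeff_mk]
      split_ifs with hn
      · rw [Set.inter_eq_left.2 (by simp [hn]), Set.ncard_singleton, Nat.cast_one]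
      · rw [Set.singleton_inter_eq_empty.2 (by simpa using Ne.symm hn), Set.ncard_empty,
          Nat.cast_zero]
    rw [h, h1]
    exact .of_polynomial 1
  | insert a J ha ih =>
    set s := {y : κ → ℕ | ∀ j ∉ J, y j = 0}
    set t := {y : κ → ℕ | ∀ j ∉ insert a J, y j = 0}
    have hst : t = s ∪ (fun y => Pi.single a 1 + y) '' t := by
      ext y
      simp only [Set.mem_union, Set.mem_image, s, t, Set.mem_ofPred_eq, Finset.mem_insert, not_or]
      constructor
      · intro hy
        by_cases h : y a = 0
        · left
          intro j hj
          by_cases hja : j = a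
          · rwa [hja]
          · exact hy j ⟨hja, hj⟩
        · right
          refine ⟨y - Pi.single a 1, fun j hj => by simp [hy j hj], ?_⟩
          ext i
          by_cases hi : i = a
          · subst hi; simp; omega
          · simp [hi]
      · rintro (hy | ⟨y, hy, rfl⟩) j hj
        · exact hy j hj.2
        · simp [hj.1, hy j hj]
    have hdisj : Disjoint s ((fun y => Pi.single a 1 + y) '' t) := by
      rw [Set.disjoint_left]
      rintro _ hs ⟨y, -, rfl⟩
      simpa using hs a ha
    have heq := weightSeries_union (finite_weight_eq hwt) hdisj
    rw [← hst, weightSeries_image (wt := wt) (wt' := wt) (fun y => map_add wt _ y)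
      (add_right_injective _).injOn] at heq
    have hne : (1 - Polynomial.X ^ wt (Pi.single a 1) : ℤ[X]) ≠ 0 := by
      intro h
      have := congrArg (Polynomial.eval 0) h
      simp [(hwt a).ne'] at this
    refine .of_polynomial_mul hne ?_
    convert ih using 1
    push_cast
    rw [sub_mul, one_mul, sub_eq_iff_eq_add]
    exact heq

theorem isRationalSeries_weightSeries_univ [Finite κ] (hwt : ∀ j, 0 < wt (Pi.single j 1)) :
    IsRationalSeries (weightSeries wt Set.univ) := by
  have := Fintype.ofFinite κ
  convert isRationalSeries_weightSeries_support_subset hwt Finset.univ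
  simp

theorem isRationalSeries_weightSeries_isUpperSet [Finite κ] (hwt : ∀ j, 0 < wt (Pi.single j 1))
    {s : Set (κ → ℕ)} (hs : IsUpperSet s) : IsRationalSeries (weightSeries wt s) := by
  have hfin : {x | Minimal (· ∈ s) x}.Finite :=
    WellQuasiOrderedLE.finite_of_isAntichain (setOfPred_minimal_antichain _)
  have hs' : s = ⋃ c ∈ hfin.toFinset, Set.Ici c := by
    ext x
    simp only [Set.Finite.mem_toFinset, Set.mem_ofPred_eq, Set.mem_iUnion, Set.mem_Ici,
      exists_prop]
    constructor
    · intro hx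
      obtain ⟨b, hb, hb'⟩ := (Set.isPWO_of_wellQuasiOrderedLE s).exists_le_minimal hx
      exact ⟨b, hb', hb⟩
    · rintro ⟨c, hc, hcx⟩
      exact hs hcx hc.1
  rw [hs']
  refine isRationalSeries_weightSeries_biUnion (finite_weight_eq hwt)
    (C := fun t => ∃ c : κ → ℕ, t = Set.Ici c) ?_ ?_ _ (fun c _ => ⟨c, rfl⟩)
  · rintro _ _ ⟨c, rfl⟩ ⟨d, rfl⟩
    exact ⟨c ⊔ d, Set.Ici_inter_Ici⟩
  · rintro _ ⟨c, rfl⟩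
    have h : Set.Ici c = (fun y => c + y) '' Set.univ := by
      ext x
      simp only [Set.mem_Ici, le_iff_exists_add, Set.image_univ, Set.mem_range, eq_comm]
    rw [h, weightSeries_image (wt' := wt) (fun y => map_add wt _ y) (add_right_injective _).injOn]
    exact (isRationalSeries_weightSeries_univ hwt).X_pow_mul _

end Pi

/-! ### Finite unions of translates of a finitely generated submonoid -/

section Translates

variable {M : Type*} [AddCommMonoid M]

/-- A set is a finite union of translates of one finitely generated submonoid. -/
def IsFGTranslate (s : Set M) : Prop :=
  ∃ P : AddSubmonoid M, P.FG ∧ ∃ C : Set M, C.Finite ∧ s = C + (P : Set M)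

theorem IsFGTranslate.inter [IsCancelAdd M] {s t : Set M} (hs : IsFGTranslate s)
    (ht : IsFGTranslate t) : IsFGTranslate (s ∩ t) := by
  obtain ⟨P, hP, C, hC, rfl⟩ := hs
  obtain ⟨Q, hQ, D, hD, rfl⟩ := ht
  obtain ⟨m, f, rfl⟩ := AddSubmonoid.fg_iff_exists_fin_addMonoidHom.1 hP
  obtain ⟨n, g, rfl⟩ := AddSubmonoid.fg_iff_exists_fin_addMonoidHom.1 hQ
  let f' : (Fin m → ℕ) × (Fin n → ℕ) →+ M := f.comp (AddMonoidHom.fst _ _)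
  let g' : (Fin m → ℕ) × (Fin n → ℕ) →+ M := g.comp (AddMonoidHom.snd _ _)
  have hE : (f'.eqLocusM g').FG := by
    refine AddSubmonoid.fg_of_subtractive fun x hx y hxy => ?_
    rw [AddMonoidHom.mem_eqLocusM] at *
    rw [map_add, map_add, hx] at hxy
    exact add_left_cancel hxy
  let Z (p : M × M) : Set ((Fin m → ℕ) × (Fin n → ℕ)) := {x | p.1 + f' x = p.2 + g' x}
  refine ⟨(f'.eqLocusM g').map f', hE.map f',
    ⋃ p ∈ C ×ˢ D, (fun x => p.1 + f' x) '' {x | Minimal (· ∈ Z p) x},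
    (hC.prod hD).biUnion fun p _ => (WellQuasiOrderedLE.finite_of_isAntichain
      (setOfPred_minimal_antichain _)).image _, ?_⟩
  ext x
  constructor
  · rintro ⟨⟨c, hc, _, ⟨u, rfl⟩, rfl⟩, ⟨d, hd, _, ⟨v, rfl⟩, h⟩⟩
    have huv : (u, v) ∈ Z (c, d) := h.symm
    obtain ⟨b, hb, hb'⟩ := (Set.isPWO_of_wellQuasiOrderedLE (Z (c, d))).exists_le_minimal huv
    obtain ⟨e, he⟩ := le_iff_exists_add.1 hb
    have hbZ : c + f' b = d + g' b := hb'.1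
    have heq : f' e = g' e := by
      have : c + f' (u, v) = d + g' (u, v) := huv
      rw [he, map_add, map_add, ← add_assoc, ← add_assoc, hbZ] at this
      exact add_left_cancel this
    refine ⟨c + f' b, Set.mem_biUnion (show (c, d) ∈ C ×ˢ D from ⟨hc, hd⟩) ⟨b, hb', rfl⟩,
      f' e, ⟨e, heq, rfl⟩, ?_⟩
    show c + f' b + f' e = c + f' (u, v)
    rw [he, map_add, add_assoc]
  · rintro ⟨y, hy, _, ⟨e, he, rfl⟩, rfl⟩
    simp only [Set.mem_iUnion] at hy
    obtain ⟨⟨c, d⟩, ⟨hc, hd⟩, b, hb, rfl⟩ := hy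
    have hbZ : c + f' b = d + g' b := hb.1
    have he' : f' e = g' e := he
    refine ⟨⟨c, hc, f' (b + e), ⟨_, rfl⟩, ?_⟩, ⟨d, hd, g' (b + e), ⟨_, rfl⟩, ?_⟩⟩
    · simp only [map_add, add_assoc]
    · simp only [map_add, ← add_assoc, he', hbZ]

/-- Every element of `c + range f` outside `V` has a lexicographically least representation, and
the vectors that are not such representations form an upper set. -/
theorem isRationalSeries_weightSeries_union_range {wt : M →+ ℕ}
    (hfin : ∀ n, {x | wt x = n}.Finite) {κ : Type*} [Finite κ] [LinearOrder κ]
    {f : (κ → ℕ) →+ M} (hf : ∀ y, wt (f y) = 0 → y = 0) {V : Set M}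
    (hV : ∀ v ∈ V, ∀ y, v + f y ∈ V) (hrat : IsRationalSeries (weightSeries wt V)) (c : M) :
    IsRationalSeries (weightSeries wt (V ∪ Set.range fun y => c + f y)) := by
  have hwt : ∀ j, 0 < (wt.comp f) (Pi.single j 1) := fun j =>
    Nat.pos_of_ne_zero fun h => one_ne_zero (Pi.single_eq_zero_iff.1 (hf _ h))
  let R : Set (κ → ℕ) := {y | c + f y ∉ V ∧ ∀ y', c + f y' = c + f y → toLex y ≤ toLex y'}
  have hR : IsUpperSet Rᶜ := by
    intro y z hyz hy
    obtain ⟨e, rfl⟩ := le_iff_exists_add.1 hyz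
    simp only [R, Set.mem_compl_iff, Set.mem_ofPred_eq, not_and_or, not_not, not_forall,
      not_le] at hy ⊢
    rw [map_add, ← add_assoc]
    obtain hy | ⟨y', h, hlt⟩ := hy
    · exact .inl (hV _ hy e)
    · refine .inr ⟨y' + e, by rw [map_add, ← add_assoc, h], ?_⟩
      rw [toLex_add, toLex_add]
      exact add_lt_add_left hlt _
  have hRrat : IsRationalSeries (weightSeries (wt.comp f) R) := by
    have h := weightSeries_union (finite_weight_eq hwt) (disjoint_compl_right (a := R))
    rw [Set.union_compl_self] at h
    rw [eq_sub_of_add_eq h.symm]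
    exact (isRationalSeries_weightSeries_univ hwt).sub
      (isRationalSeries_weightSeries_isUpperSet hwt hR)
  have hU : V ∪ Set.range (fun y => c + f y) = V ∪ (fun y => c + f y) '' R := by
    refine subset_antisymm (Set.union_subset Set.subset_union_left ?_)
      (Set.union_subset_union_right _ (Set.image_subset_range _ _))
    rintro _ ⟨y, rfl⟩
    by_cases hy : c + f y ∈ V
    · exact .inl hy
    · right
      obtain ⟨z, hz, hmin⟩ := WellFounded.has_min (wellFounded_lt (α := Lex (κ → ℕ)))
        {z | c + f (ofLex z) = c + f y} ⟨toLex y, rfl⟩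
      refine ⟨ofLex z, ⟨?_, fun y' hy' => not_lt.1 (hmin (toLex y') (hy'.trans hz))⟩, hz⟩
      rw [(hz : c + f (ofLex z) = c + f y)]
      exact hy
  rw [hU, weightSeries_union hfin, weightSeries_image (wt' := wt.comp f) (fun y => map_add wt _ _)]
  · exact hrat.add (hRrat.X_pow_mul _)
  · intro y hy z hz h
    exact toLex.injective (le_antisymm (hy.2 z h.symm) (hz.2 y h))
  · rw [Set.disjoint_left]
    rintro _ hv ⟨y, hy, rfl⟩
    exact hy.1 hv

theorem IsFGTranslate.isRationalSeries {wt : M →+ ℕ}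
    (hfin : ∀ n, {x | wt x = n}.Finite) (hpos : ∀ x, wt x = 0 → x = 0) {s : Set M}
    (hs : IsFGTranslate s) : IsRationalSeries (weightSeries wt s) := by
  classical
  obtain ⟨P, ⟨t, rfl⟩, C, hC, rfl⟩ := hs
  let κ := t.erase 0
  let : LinearOrder κ := LinearOrder.lift' (Fintype.equivFin κ) (Fintype.equivFin κ).injective
  let f : (κ → ℕ) →+ M := ∑ i, (multiplesHom M i.1).comp (Pi.evalAddMonoidHom _ i)
  have hf (y) : f y = ∑ i : κ, y i • i.1 := by simp [f]
  clear_value f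
  have hrange (c : M) :
      (fun x => c + x) '' (AddSubmonoid.closure (t : Set M) : Set M) =
        Set.range fun y => c + f y := by
    have : AddSubmonoid.closure (t : Set M) = AddSubmonoid.closure (κ : Set M) := by
      simp [κ]
    ext x
    simp only [this, Set.mem_image, SetLike.mem_coe, AddSubmonoid.mem_closure_finset', ← hf]
    simp
  have hfwt (y) (hy : wt (f y) = 0) : y = 0 := by
    simp only [hf, map_sum, map_nsmul, smul_eq_mul, Finset.sum_eq_zero_iff, Finset.mem_univ,
      true_imp_iff, mul_eq_zero] at hy
    ext j
    exact (hy j).resolve_right fun h => Finset.ne_of_mem_erase j.2 (hpos _ h)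
  induction C, hC using Set.Finite.induction_on with
  | empty => simpa using IsRationalSeries.zero
  | @insert c C _ _ ih =>
    rw [Set.insert_eq, Set.union_add, Set.union_comm, Set.singleton_add, hrange]
    refine isRationalSeries_weightSeries_union_range hfin hfwt ?_ ih c
    rintro _ ⟨c, hc, x, hx, rfl⟩ y
    refine ⟨c, hc, x + f y, add_mem hx ?_, (add_assoc _ _ _).symm⟩
    rw [hf]
    exact sum_mem fun i _ => nsmul_mem
      (AddSubmonoid.subset_closure (Finset.mem_of_mem_erase i.2)) _

/-- A semilinear set in a cancellative commutative monoid has a rational counting series with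
respect to any positive weight with finite fibres. -/
theorem _root_.IsSemilinearSet.isRationalSeries_weightSeries [IsCancelAdd M] {wt : M →+ ℕ}
    (hfin : ∀ n, {x | wt x = n}.Finite) (hpos : ∀ x, wt x = 0 → x = 0) {s : Set M}
    (hs : IsSemilinearSet s) : IsRationalSeries (weightSeries wt s) := by
  obtain ⟨S, hS, rfl⟩ := isSemilinearSet_iff.1 hs
  rw [Set.sUnion_eq_biUnion]
  refine isRationalSeries_weightSeries_biUnion hfin (fun _ _ => IsFGTranslate.inter)
    (fun _ => IsFGTranslate.isRationalSeries hfin hpos) S fun t ht => ?_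
  obtain ⟨a, P, hP, rfl⟩ := isLinearSet_iff_exists_fg_eq_vadd.1 (hS t ht)
  exact ⟨P, hP, {a}, Set.finite_singleton a, by rw [Set.singleton_add]; rfl⟩

end Translates

/-! ### Path sums in a finite labelled graph -/

section Path

variable {V E M : Type*} [AddCommMonoid M]

/-- `PathSum src tgt lab U p q v` says that `v` is the sum of the labels along a nonempty path from
`p` to `q` all of whose intermediate vertices are in `U`. -/
inductive PathSum (src tgt : E → V) (lab : E → M) (U : Set V) : V → V → M → Prop
  | edge (e : E) : PathSum src tgt lab U (src e) (tgt e) (lab e)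
  | cons (e : E) {q : V} {v : M} (he : tgt e ∈ U) (h : PathSum src tgt lab U (tgt e) q v) :
      PathSum src tgt lab U (src e) q (lab e + v)

variable {src tgt : E → V} {lab : E → M} {U : Set V} {p q u : V}

theorem PathSum.mono {U' : Set V} (hU : U ⊆ U') {v : M} (h : PathSum src tgt lab U p q v) :
    PathSum src tgt lab U' p q v := by
  induction h with
  | edge e => exact .edge e
  | cons e he _ ih => exact .cons e (hU he) ih

theorem PathSum.trans {a b : M} (hu : u ∈ U) (h : PathSum src tgt lab U p u a)
    (h' : PathSum src tgt lab U u q b) : PathSum src tgt lab U p q (a + b) := by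
  induction h with
  | edge e => exact .cons e hu h'
  | cons e he _ ih => rw [add_assoc]; exact .cons e he (ih hu h')

theorem setOf_pathSum_insert :
    {v | PathSum src tgt lab (insert u U) p q v} = {v | PathSum src tgt lab U p q v} ∪
      ({v | PathSum src tgt lab U p u v} +
        ((AddSubmonoid.closure {v | PathSum src tgt lab U u u v} : Set M) +
          {v | PathSum src tgt lab U u q v})) := by
  ext v
  constructor
  · intro h
    induction h with
    | edge e => exact .inl (.edge e)
    | @cons e q v he h ih =>
      obtain he | he := he
      · rw [he] at ih
        right
        obtain ih | ⟨a, ha, _, ⟨b, hb, c, hc, rfl⟩, rfl⟩ := ih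
        · exact ⟨lab e, he ▸ .edge e, v, ⟨0, zero_mem _, v, ih, zero_add v⟩, rfl⟩
        · exact ⟨lab e, he ▸ .edge e, a + (b + c),
            ⟨a + b, add_mem (AddSubmonoid.subset_closure ha) hb, c, hc, add_assoc _ _ _⟩, rfl⟩
      · obtain ih | ⟨a, ha, b, hb, rfl⟩ := ih
        · exact .inl (.cons e he ih)
        · exact .inr ⟨lab e + a, .cons e he ha, b, hb, add_assoc _ _ _⟩
  · have hU : U ⊆ insert u U := Set.subset_insert u U
    have hu : u ∈ insert u U := Set.mem_insert u U
    rintro (h | ⟨a, ha, _, ⟨b, hb, c, hc, rfl⟩, rfl⟩)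
    · exact h.mono hU
    · refine (PathSum.mono hU ha).trans hu ?_
      induction hb using AddSubmonoid.closure_induction_left with
      | zero => simpa using PathSum.mono hU hc
      | add_left x hx y _ ih =>
        simp only [add_assoc]
        exact (PathSum.mono hU hx).trans hu ih

theorem isSemilinearSet_pathSum [Finite V] [Finite E] (U : Set V) (p q : V) :
    IsSemilinearSet {v | PathSum src tgt lab U p q v} := by
  induction U, U.toFinite using Set.Finite.induction_on generalizing p q with
  | empty =>
    refine .of_finite ((Set.finite_range lab).subset ?_)
    rintro v (e | ⟨e, he, -⟩)
    · exact ⟨e, rfl⟩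
    · exact he.elim
  | insert _ _ ih =>
    rw [setOf_pathSum_insert]
    exact (ih p q).union ((ih _ _).add ((ih _ _).closure.add (ih _ _)))

end Path

/-! ### Canonical representatives of least weight -/

section Representatives

theorem isSemilinearSet_setOf_lt {M : Type*} [AddCommMonoid M] [AddMonoid.FG M] (f g : M →+ ℕ) :
    IsSemilinearSet {x | f x < g x} := by
  have h : IsSemilinearSet ((0, 1) +ᵥ (AddSubmonoid.closure {(1, 1), (0, 1)} : Set (ℕ × ℕ))) :=
    (IsSemilinearSet.closure_of_finite (by simp)).vadd _
  convert h.preimage (f.prod g) using 1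
  ext x
  simp only [Set.mem_ofPred_eq, Set.mem_preimage, Set.mem_vadd_set, SetLike.mem_coe,
    AddSubmonoid.mem_closure_pair, AddMonoidHom.prod_apply, vadd_eq_add]
  constructor
  · intro hx
    refine ⟨_, ⟨f x, g x - f x - 1, rfl⟩, ?_⟩
    ext
    · simp
    · simp; omega
  · rintro ⟨_, ⟨m, n, rfl⟩, h⟩
    simp [Prod.ext_iff] at h
    omega

variable {ι : Type*} [Finite ι]

theorem isSemilinearSet_setOf_toLex_lt [LinearOrder ι] :
    IsSemilinearSet {p : (ι → ℕ) × (ι → ℕ) | toLex p.2 < toLex p.1} := by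
  have h : {p : (ι → ℕ) × (ι → ℕ) | toLex p.2 < toLex p.1} =
      ⋃ i, (⋂ j : Set.Iio i, {p | p.2 j = p.1 j}) ∩ {p | p.2 i < p.1 i} := by
    ext p
    simp only [Set.mem_ofPred_eq, Set.mem_iUnion, Set.mem_inter_iff, Set.mem_iInter,
      Subtype.forall, Set.mem_Iio]
    rfl
  rw [h]
  refine .iUnion fun i => .inter (.iInter fun j => ?_) ?_
  · simpa using isSemilinearSet_setOfPred_eq (0 : ℕ) 0
      ((Pi.evalAddMonoidHom (fun _ : ι => ℕ) j).comp (AddMonoidHom.snd (ι → ℕ) (ι → ℕ)))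
      ((Pi.evalAddMonoidHom (fun _ : ι => ℕ) j).comp (AddMonoidHom.fst (ι → ℕ) (ι → ℕ)))
  · exact isSemilinearSet_setOf_lt
      ((Pi.evalAddMonoidHom (fun _ : ι => ℕ) i).comp (AddMonoidHom.snd (ι → ℕ) (ι → ℕ)))
      ((Pi.evalAddMonoidHom (fun _ : ι => ℕ) i).comp (AddMonoidHom.fst (ι → ℕ) (ι → ℕ)))

/-- The well-order on indexed vectors that compares weights, then indices, then the vectors
lexicographically. -/
def repKey {F : Type*} (wt : (ι → ℕ) →+ ℕ) (f : F) (y : ι → ℕ) : ℕ ×ₗ F ×ₗ Lex (ι → ℕ) :=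
  toLex (wt y, toLex (f, toLex y))

theorem isSemilinearSet_setOf_repKey_lt [LinearOrder ι] {F : Type*} [LinearOrder F]
    (wt : (ι → ℕ) →+ ℕ) (f f' : F) :
    IsSemilinearSet {p : (ι → ℕ) × (ι → ℕ) | repKey wt f' p.2 < repKey wt f p.1} := by
  have h : {p : (ι → ℕ) × (ι → ℕ) | repKey wt f' p.2 < repKey wt f p.1} =
      {p | wt p.2 < wt p.1} ∪ ({p | wt p.2 = wt p.1} ∩
        ({p | f' < f} ∪ ({p | f' = f} ∩ {p | toLex p.2 < toLex p.1}))) := by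
    ext p
    simp [repKey, Prod.Lex.toLex_lt_toLex]
  have hconst (P : Prop) : IsSemilinearSet {_p : (ι → ℕ) × (ι → ℕ) | P} := by
    by_cases hP : P <;> simp [hP]
  rw [h]
  refine .union ?_ (.inter ?_ (.union (hconst _) (.inter (hconst _)
    isSemilinearSet_setOf_toLex_lt)))
  · exact isSemilinearSet_setOf_lt (wt.comp (AddMonoidHom.snd (ι → ℕ) (ι → ℕ)))
      (wt.comp (AddMonoidHom.fst (ι → ℕ) (ι → ℕ)))
  · simpa using isSemilinearSet_setOfPred_eq (0 : ℕ) 0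
      (wt.comp (AddMonoidHom.snd (ι → ℕ) (ι → ℕ))) (wt.comp (AddMonoidHom.fst (ι → ℕ) (ι → ℕ)))

variable {F Q : Type*} (wt : (ι → ℕ) →+ ℕ) (R : F → Set (ι → ℕ)) (κ : F → (ι → ℕ) → Q)

/-- The vectors `y ∈ R f` such that `(f, y)` is the least representative of `κ f y`. -/
def leastReps [LinearOrder ι] [LinearOrder F] (f : F) : Set (ι → ℕ) :=
  {y ∈ R f | ∀ f', ∀ y' ∈ R f', κ f' y' = κ f y → repKey wt f y ≤ repKey wt f' y'}

variable {wt R κ}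

theorem isSemilinearSet_leastReps [LinearOrder ι] [LinearOrder F] [Finite F]
    (hR : ∀ f, IsSemilinearSet (R f))
    (hκ : ∀ f f', IsSemilinearSet {p : (ι → ℕ) × (ι → ℕ) | κ f p.1 = κ f' p.2}) (f : F) :
    IsSemilinearSet (leastReps wt R κ f) := by
  have h : leastReps wt R κ f = R f \ ⋃ f', AddMonoidHom.fst (ι → ℕ) (ι → ℕ) ''
      ({p | κ f p.1 = κ f' p.2} ∩ (AddMonoidHom.snd (ι → ℕ) (ι → ℕ) ⁻¹' R f') ∩
        {p | repKey wt f' p.2 < repKey wt f p.1}) := by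
    ext y
    simp only [leastReps, Set.mem_sdiff, Set.mem_iUnion, Set.mem_image, Set.mem_inter_iff,
      Set.mem_ofPred_eq, Set.mem_preimage, AddMonoidHom.coe_fst, AddMonoidHom.coe_snd,
      Prod.exists, not_exists]
    refine and_congr_right fun _ => forall_congr' fun f' => ⟨?_, ?_⟩
    · rintro h _ y' ⟨⟨⟨h1, h2⟩, h3⟩, rfl⟩
      exact (h y' h2 h1.symm).not_gt h3
    · intro h y' hy' heq
      by_contra hlt
      exact h y y' ⟨⟨⟨heq.symm, hy'⟩, not_le.1 hlt⟩, rfl⟩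
  rw [h]
  exact (hR f).sdiff (.iUnion fun f' => .image (((hκ f f').inter ((hR f').preimage _)).inter
    (isSemilinearSet_setOf_repKey_lt wt f f')) _)

/-- Let `Q` be represented by vectors from finitely many semilinear sets such that equality of the
represented elements is semilinear. If `W c` is the least weight of a representative of `c`, then
`W` has finite fibres and a rational counting series. -/
theorem isRationalSeries_of_representatives [DecidableEq ι] [Finite F]
    (hwt : ∀ i, 0 < wt (Pi.single i 1)) (hR : ∀ f, IsSemilinearSet (R f))
    (hκ : ∀ f f', IsSemilinearSet {p : (ι → ℕ) × (ι → ℕ) | κ f p.1 = κ f' p.2}) {W : Q → ℕ}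
    (hW : ∀ c, IsLeast {n | ∃ f, ∃ y ∈ R f, κ f y = c ∧ wt y = n} (W c)) :
    (∀ n, {c | W c = n}.Finite) ∧
      IsRationalSeries (PowerSeries.mk fun n => ({c | W c = n}.ncard : ℤ)) := by
  have := Fintype.ofFinite F
  have := Fintype.ofFinite ι
  let : LinearOrder F := LinearOrder.lift' (Fintype.equivFin F) (Fintype.equivFin F).injective
  let : LinearOrder ι := LinearOrder.lift' (Fintype.equivFin ι) (Fintype.equivFin ι).injective
  have hfin := finite_weight_eq hwt
  have hinj {f f' y y'} (hy : y ∈ leastReps wt R κ f) (hy' : y' ∈ leastReps wt R κ f')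
      (h : κ f y = κ f' y') : f = f' ∧ y = y' := by
    have := le_antisymm (hy.2 f' y' hy'.1 h.symm) (hy'.2 f y hy.1 h)
    simp only [repKey, EmbeddingLike.apply_eq_iff_eq, Prod.mk.injEq] at this
    exact this.2
  have hsphere (n : ℕ) :
      {c | W c = n} = ⋃ f, κ f '' (leastReps wt R κ f ∩ {y | wt y = n}) := by
    have hweight {f y} (hy : y ∈ leastReps wt R κ f) : W (κ f y) = wt y := by
      obtain ⟨f', y', hy', h, hw⟩ := (hW (κ f y)).1
      refine le_antisymm ((hW (κ f y)).2 ⟨f, y, hy.1, rfl, rfl⟩) ?_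
      have := hy.2 f' y' hy' h
      rw [repKey, repKey, Prod.Lex.toLex_le_toLex] at this
      rw [← hw]
      rcases this with h | h
      · exact h.le
      · exact h.1.le
    ext c
    simp only [Set.mem_ofPred_eq, Set.mem_iUnion, Set.mem_image, Set.mem_inter_iff]
    constructor
    · rintro rfl
      obtain ⟨f, y, hy, h, -⟩ := (hW c).1
      obtain ⟨⟨f', y'⟩, ⟨hy', rfl⟩, hmin⟩ := WellFounded.has_min
        (InvImage.wf (fun p : F × (ι → ℕ) => repKey wt p.1 p.2) wellFounded_lt)
        {p | p.2 ∈ R p.1 ∧ κ p.1 p.2 = c} ⟨(f, y), hy, h⟩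
      have hmem : y' ∈ leastReps wt R κ f' :=
        ⟨hy', fun f'' y'' h1 h2 => not_lt.1 (hmin (f'', y'') ⟨h1, h2⟩)⟩
      exact ⟨f', y', ⟨hmem, (hweight hmem).symm⟩, rfl⟩
    · rintro ⟨f, y, ⟨hy, rfl⟩, rfl⟩
      exact hweight hy
  have hfin' (n : ℕ) (f : F) : (κ f '' (leastReps wt R κ f ∩ {y | wt y = n})).Finite :=
    ((hfin n).subset Set.inter_subset_right).image _
  refine ⟨fun n => hsphere n ▸ Set.finite_iUnion (hfin' n), ?_⟩
  convert IsRationalSeries.sum Finset.univ fun f _ =>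
    (isSemilinearSet_leastReps (wt := wt) hR hκ f).isRationalSeries_weightSeries hfin
      fun _ => eq_zero_of_weight_eq_zero hwt
  ext n
  rw [PowerSeries.coeff_mk, map_sum, hsphere,
    Set.ncard_iUnion_of_finite (hfin' n), finsum_eq_sum_of_fintype, Nat.cast_sum]
  · refine Finset.sum_congr rfl fun f _ => ?_
    rw [weightSeries, PowerSeries.coeff_mk, Set.InjOn.ncard_image]
    exact fun y hy y' hy' h => (hinj hy.1 hy'.1 h).2
  · intro f f' hne
    rw [Function.onFun, Set.disjoint_left]
    rintro _ ⟨y, hy, rfl⟩ ⟨y', hy', h⟩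
    exact hne (hinj hy'.1 hy.1 h).1.symm

end Representatives

open scoped IsMulCommutative

variable {G : Type*} [Group G]

/-! ### Weights of cosets in terms of words -/

theorem isLeast_cosetWeight {S : Set G} (hgen : Submonoid.closure S = ⊤) (ω : S → ℕ+)
    (H : Subgroup G) (c : RightCosets H) :
    IsLeast {n | ∃ w : List S, Quotient.mk (QuotientGroup.rightRel H) (wordValue w) = c ∧
      wordWeight ω w = n} (cosetWeight ω H c) := by
  have hword (g : G) : ∃ w : List S, wordValue w = g ∧ wordWeight ω w = elementWeight ω g := by
    refine Nat.sInf_mem (s := {n | ∃ w : List S, wordValue w = g ∧ wordWeight ω w = n}) ?_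
    obtain ⟨l, hl, hg⟩ := Submonoid.exists_list_of_mem_closure
      (show g ∈ Submonoid.closure S by simp [hgen])
    lift l to List S using hl
    exact ⟨_, l, by simpa [wordValue] using hg, rfl⟩
  constructor
  · obtain ⟨g, hg⟩ := Quotient.exists_rep c
    obtain ⟨g', hg', hn⟩ := Nat.sInf_mem (s := {n | ∃ g : G,
      (Quotient.mk (QuotientGroup.rightRel H) g) = c ∧ elementWeight ω g = n}) ⟨_, g, hg, rfl⟩
    obtain ⟨w, rfl, hw⟩ := hword g'
    exact ⟨w, hg', hw.trans hn⟩
  · rintro _ ⟨w, hw, rfl⟩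
    have h : cosetWeight ω H c ≤ elementWeight ω (wordValue w) :=
      Nat.sInf_le ⟨wordValue w, hw, rfl⟩
    exact h.trans (Nat.sInf_le ⟨w, rfl, rfl⟩)

/-! ### Words as paths in the Schreier graph of a normal subgroup -/

section Words

variable (A : Subgroup G) {S : Set G}

/-- The additive map that weighs every edge of the Schreier graph by its generator. -/
noncomputable def edgeWeight [Finite (G ⧸ A)] [Finite S] (ω : S → ℕ+) :
    ((G ⧸ A) × S → ℕ) →+ ℕ :=
  have := Fintype.ofFinite ((G ⧸ A) × S)
  ∑ e, (multiplesHom ℕ (ω e.2 : ℕ)).comp (Pi.evalAddMonoidHom (fun _ => ℕ) e)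

open Classical in
theorem edgeWeight_single [Finite (G ⧸ A)] [Finite S] (ω : S → ℕ+) (e : (G ⧸ A) × S) :
    edgeWeight A ω (Pi.single e 1) = ω e.2 := by
  rw [edgeWeight, AddMonoidHom.finsetSum_apply, Finset.sum_eq_single e] <;>
    simp +contextual

variable [A.Normal]

open Classical in
/-- The number of passages through each edge of the Schreier graph of `A` along a word that starts
at the vertex `f`. -/
noncomputable def edgeCount : List S → G ⧸ A → ((G ⧸ A) × S → ℕ)
  | [], _ => 0
  | s :: w, f => Pi.single (f, s) 1 + edgeCount w (f * (s : G))

/-- The Schreier generator of `A` that belongs to an edge of the Schreier graph. -/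
noncomputable def schreierGenerator (e : (G ⧸ A) × S) : A :=
  ⟨e.1.out * e.2 * (e.1 * ((e.2 : G) : G ⧸ A)).out⁻¹, by
    rw [← QuotientGroup.eq_one_iff]
    simp⟩

/-- The additive map that sends every edge to its Schreier generator. -/
noncomputable def edgeValue [IsMulCommutative A] [Finite (G ⧸ A)] [Finite S] :
    ((G ⧸ A) × S → ℕ) →+ Additive A :=
  have := Fintype.ofFinite ((G ⧸ A) × S)
  ∑ e, (multiplesHom (Additive A) (Additive.ofMul (schreierGenerator A e))).comp
    (Pi.evalAddMonoidHom (fun _ => ℕ) e)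

theorem wordValue_cons (s : S) (w : List S) : wordValue (s :: w) = s * wordValue w := by
  simp [wordValue]

theorem exists_edgeCount_eq_iff (f f' : G ⧸ A) (y : (G ⧸ A) × S → ℕ) :
    (∃ w : List S, edgeCount A w f = y ∧ f * (wordValue w : G) = f') ↔
      (y = 0 ∧ f = f') ∨ PathSum (fun e : (G ⧸ A) × S => e.1) (fun e => e.1 * ((e.2 : G) : G ⧸ A))
        (fun e => by classical exact Pi.single e 1) Set.univ f f' y := by
  classical
  constructor
  · rintro ⟨w, rfl, rfl⟩
    induction w generalizing f with
    | nil => exact .inl ⟨rfl, by simp [wordValue]⟩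
    | cons s w ih =>
      right
      rw [wordValue_cons, QuotientGroup.mk_mul, ← mul_assoc, edgeCount]
      obtain ⟨h, h'⟩ | h := ih (f * (s : G))
      · rw [h, ← h', add_zero]
        convert PathSum.edge (f, s)
      · convert PathSum.cons (f, s) (Set.mem_univ _) h
  · rintro (⟨rfl, rfl⟩ | h)
    · exact ⟨[], rfl, by simp [wordValue]⟩
    · induction h with
      | edge e => exact ⟨[e.2], by simp only [edgeCount, add_zero, Prod.mk.eta],
          by simp [wordValue]⟩
      | cons e _ _ ih =>
        obtain ⟨w, rfl, rfl⟩ := ih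
        exact ⟨e.2 :: w, by simp only [edgeCount, Prod.mk.eta],
          by rw [wordValue_cons, QuotientGroup.mk_mul, mul_assoc]⟩

variable [Finite (G ⧸ A)] [Finite S]

theorem isSemilinearSet_edgeCount (f f' : G ⧸ A) :
    IsSemilinearSet {y | ∃ w : List S, edgeCount A w f = y ∧ f * (wordValue w : G) = f'} := by
  simp only [exists_edgeCount_eq_iff]
  refine IsSemilinearSet.union (s₁ := {y | y = 0 ∧ f = f'}) ?_ (isSemilinearSet_pathSum _ _ _)
  exact .of_finite ((Set.finite_singleton 0).subset fun y hy => hy.1)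

theorem edgeWeight_edgeCount (ω : S → ℕ+) (w : List S) (f : G ⧸ A) :
    edgeWeight A ω (edgeCount A w f) = wordWeight ω w := by
  induction w generalizing f with
  | nil => simp [edgeCount, wordWeight]
  | cons s w ih => rw [edgeCount, map_add, edgeWeight_single, ih]; simp [wordWeight]

variable [IsMulCommutative A]

open Classical in
theorem edgeValue_single (e : (G ⧸ A) × S) :
    edgeValue A (Pi.single e 1) = Additive.ofMul (schreierGenerator A e) := by
  rw [edgeValue, AddMonoidHom.finsetSum_apply, Finset.sum_eq_single e] <;>
    simp +contextual

theorem edgeValue_edgeCount (w : List S) (f : G ⧸ A) :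
    ((edgeValue A (edgeCount A w f)).toMul : G) * (f * (wordValue w : G)).out =
      f.out * wordValue w := by
  induction w generalizing f with
  | nil => simp [edgeCount, wordValue]
  | cons s w ih =>
    rw [edgeCount, map_add, edgeValue_single, toMul_add, toMul_ofMul, Subgroup.coe_mul,
      wordValue_cons, QuotientGroup.mk_mul, ← mul_assoc f, mul_assoc, ih, schreierGenerator]
    simp [mul_assoc]

end Words

/-! ### Equality of cosets is semilinear -/

section Cosets

variable {M : Type*} [AddCommMonoid M] [AddMonoid.FG M] (A H : Subgroup G) [IsMulCommutative A]

theorem isSemilinearSet_setOf_mul_mem (θ : M →+ Additive A) (c : G) :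
    IsSemilinearSet {x | ((θ x).toMul : G) * c ∈ H} := by
  obtain h | ⟨x₀, hx₀⟩ := Set.eq_empty_or_nonempty {x | ((θ x).toMul : G) * c ∈ H}
  · rw [h]
    exact .empty
  let π : M →+ Additive (A ⧸ H.subgroupOf A) :=
    (QuotientGroup.mk' (H.subgroupOf A)).toAdditive.comp θ
  convert isSemilinearSet_setOfPred_eq (π x₀) 0 (0 : M →+ Additive (A ⧸ H.subgroupOf A)) π
    using 1
  ext x
  have hπ : π x₀ = π x ↔ ((θ x₀).toMul : G)⁻¹ * (θ x).toMul ∈ H := by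
    rw [← Subgroup.coe_inv, ← Subgroup.coe_mul, ← Subgroup.mem_subgroupOf, ← QuotientGroup.eq]
    rfl
  have hcomm : ((θ x₀).toMul : G)⁻¹ * (θ x).toMul =
      (θ x).toMul * ((θ x₀).toMul : G)⁻¹ := by
    rw [← Subgroup.coe_inv, ← Subgroup.coe_mul, mul_comm, Subgroup.coe_mul]
  simp only [Set.mem_ofPred_eq, AddMonoidHom.zero_apply, add_zero, zero_add, hπ, hcomm]
  rw [← H.mul_mem_cancel_right (y := (θ x).toMul * ((θ x₀).toMul : G)⁻¹) hx₀, ← mul_assoc,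
    inv_mul_cancel_right]

theorem isSemilinearSet_setOf_mk_eq [A.Normal] (φ ψ : M →+ Additive A) (a b c : G) :
    IsSemilinearSet {x | (Quotient.mk (QuotientGroup.rightRel H) (a * (φ x).toMul * b)) =
      Quotient.mk (QuotientGroup.rightRel H) (a * (ψ x).toMul * c)} := by
  let conj (g : G) : Additive A →+ Additive A :=
    (MulAut.conjNormal g : A ≃* A).toMonoidHom.toAdditive
  convert isSemilinearSet_setOf_mul_mem A H
    ((conj a).comp ψ - (conj (a * c * b⁻¹)).comp φ) (a * c * b⁻¹ * a⁻¹) using 1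
  ext x
  rw [Set.mem_ofPred_eq, Set.mem_ofPred_eq, Quotient.eq, QuotientGroup.rightRel_apply]
  have : ((((conj a).comp ψ - (conj (a * c * b⁻¹)).comp φ) x).toMul : G) =
      (a * (ψ x).toMul * a⁻¹) * (a * c * b⁻¹ * (φ x).toMul * (a * c * b⁻¹)⁻¹)⁻¹ := by
    simp [conj, div_eq_mul_inv, mul_assoc]
  rw [this]
  congr! 1
  group

end Cosets

end CosetGrowth

theorem theoremB {G : Type*} [Group G] (hG : CosetGrowth.IsVirtuallyAbelian G)
    (S : Set G) (hfin : S.Finite) (hgen : Submonoid.closure S = ⊤) (ω : S → ℕ+)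
    (H : Subgroup G) :
    (∀ n : ℕ, (CosetGrowth.cosetSphere ω H n).Finite) ∧
      CosetGrowth.IsRationalSeries (CosetGrowth.cosetGrowthSeries ω H) := by
  classical
  obtain ⟨B, hB, hB'⟩ := hG
  let A := B.normalCore
  have : Finite S := hfin
  have : IsMulCommutative A := ⟨⟨fun a b => Subtype.ext <| congrArg (Subtype.val : B → G) <|
    hB.is_comm.comm ⟨a, B.normalCore_le a.2⟩ ⟨b, B.normalCore_le b.2⟩⟩⟩
  have : Finite (G ⧸ A) := Subgroup.finite_quotient_of_finiteIndex
  refine CosetGrowth.isRationalSeries_of_representatives (wt := CosetGrowth.edgeWeight A ω)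
    (R := fun f => {y | ∃ w : List S, CosetGrowth.edgeCount A w 1 = y ∧
      1 * ((CosetGrowth.wordValue w : G) : G ⧸ A) = f})
    (κ := fun f y => Quotient.mk (QuotientGroup.rightRel H)
      ((1 : G ⧸ A).out⁻¹ * (CosetGrowth.edgeValue A y).toMul * f.out))
    (fun e => by rw [CosetGrowth.edgeWeight_single]; exact (ω e.2).pos)
    (CosetGrowth.isSemilinearSet_edgeCount A 1)
    (fun f f' => CosetGrowth.isSemilinearSet_setOf_mk_eq A H
      ((CosetGrowth.edgeValue A).comp (AddMonoidHom.fst ((G ⧸ A) × S → ℕ) ((G ⧸ A) × S → ℕ)))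
      ((CosetGrowth.edgeValue A).comp (AddMonoidHom.snd ((G ⧸ A) × S → ℕ) ((G ⧸ A) × S → ℕ))) _ _ _)
    fun c => ?_
  convert CosetGrowth.isLeast_cosetWeight hgen ω H c using 1
  ext n
  constructor
  · rintro ⟨_, _, ⟨w, rfl, rfl⟩, hc, hn⟩
    rw [mul_assoc, CosetGrowth.edgeValue_edgeCount, inv_mul_cancel_left] at hc
    exact ⟨w, hc, by rw [← hn, CosetGrowth.edgeWeight_edgeCount]⟩
  · rintro ⟨w, hc, hn⟩
    refine ⟨_, _, ⟨w, rfl, rfl⟩, ?_, by rw [← hn, CosetGrowth.edgeWeight_edgeCount]⟩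
    rw [mul_assoc, CosetGrowth.edgeValue_edgeCount, inv_mul_cancel_left, hc]
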